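/- Let $k$ be a field. A signed graph $G$ consists of a finite vertex set $V=\{1,\dots,d\}$ and a set $E(G)$ of signed edges $+ij$ or $-ij$ with $i,j\in V$; loops ($i=j$) are allowed, and between two vertices there is at most one edge of each sign (in particular, graphs with at most one signed edge between any two vertices are included). For $e=\pm ij\in E(G)$ put $\operatorname{sgn}(e)=\pm1$ and $\rho(e)=\operatorname{sgn}(e)(e_i+e_j)\in\mathbb Z^d$, so that $\rho(\pm ii)=\pm 2e_i$. Let $\mathcal P_G=\operatorname{conv}\rho(E(G))$ and $$T_1=\operatorname{cone}(\mathcal P_G)\cap\mathbb Z\rho(E(G))=\mathbb R_{+}\rho(E(G))\cap\mathbb Z\rho(E(G)).$$ In the Laurent polynomial ring $k[x_1^{\pm1},\dots,x_d^{\pm1}]$ let $k[G]$ be the $k$-subalgebra generated by the monomials $x^{\rho(e)}$, $e\in E(G)$ (the edge ring), and let $\mathcal A(\mathcal P_G)=k[T_1]$ be the $k$-subalgebra generated by the monomials $x^a$, $a\in T_1$ (the Ehrhart ring). An odd cycle of $G$ is a cycle (no repeated vertex or edge) of odd length; a loop is an odd cycle of length one. An alternating path is a path (no repeated vertex) whose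 consecutive edges have opposite signs. An exceptional pair $\Pi=\{C,C'\}$ consists of two vertex-disjoint odd cycles $C,C'$ in the same connected component of $G$ such that there is no alternating path in $G$ from a vertex of $C$ to a vertex of $C'$. For such a pair let $$M_\Pi=x^{\frac12\rho(\Pi)},\qquad \tfrac12\rho(\Pi)=\tfrac12\sum_{e\in C}\rho(e)+\tfrac12\sum_{e\in C'}\rho(e)\in\mathbb Z^d .$$ Theorem. For every signed graph $G$, the ring $\mathcal A(\mathcal P_G)$ is generated as a $k[G]$-algebra by the monomials $M_\Pi$, where $\Pi$ runs over all exceptional pairs of $G$. Moreover $\mathcal A(\mathcal P_G)$ is the normalization of $k[G]$, i.e. the integral closure of $k[G]$ in its field of fractions (taken inside the field of fractions of $k[x_1^{\pm1},\dots,x_d^{\pm1}]$). -/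

import Mathlib

/-- A signed graph on the vertex set `V`: a set of signed edges `(s, ij)`, with sign `s = ±1`.
Loops `s(i, i)` are allowed; between two vertices there is at most one edge of each sign. -/
structure SignedGraph (V : Type*) where
  edges : Set (ℤˣ × Sym2 V)

/-- The Laurent polynomial ring `k[x_v^{±1} : v ∈ V]`. -/
abbrev Laurent (V k : Type*) [Field k] : Type _ := AddMonoidAlgebra k (V → ℤ)

/-- The Laurent monomial `x^a`. -/
noncomputable def laurentMonomial {V : Type*} (k : Type*) [Field k] (a : V → ℤ) : Laurent V k :=
  AddMonoidAlgebra.single a 1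

/-- The subring of the field of fractions of the domain `L` consisting of the elements that lie in
the field of fractions of the subring `R` and are integral over `R`: the normalization of `R`. -/
def normalizationSet {k L : Type*} [Field k] [CommRing L] [IsDomain L] [Algebra k L]
    (R : Subalgebra k L) : Set (FractionRing L) :=
  {z | z ∈ Subfield.closure (algebraMap L (FractionRing L) '' (R : Set L)) ∧ IsIntegral R z}

namespace SignedGraph

/-- The number of ends of an unoriented edge at each vertex: `ij ↦ e_i + e_j`, `ii ↦ 2 e_i`. -/
def ends {V : Type*} [DecidableEq V] : Sym2 V → V → ℤ :=
  Sym2.lift ⟨fun i j => Pi.single i 1 + Pi.single j 1, fun _ _ => add_comm _ _⟩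

/-- `ρ(±ij) = ±(e_i + e_j)`. -/
def rho {V : Type*} [DecidableEq V] (e : ℤˣ × Sym2 V) : V → ℤ :=
  (e.1 : ℤ) • ends e.2

/-- An integer vector, seen as a real vector. -/
def realVec {V : Type*} (a : V → ℤ) : V → ℝ := fun v => (a v : ℝ)

section Rings

variable {V : Type*} [DecidableEq V] (G : SignedGraph V)

/-- The edge polytope, the convex hull of `ρ(E(G))`. -/
def edgePolytope : Set (V → ℝ) :=
  convexHull ℝ ((fun e => realVec (rho e)) '' G.edges)

/-- The edge lattice `ℤ ρ(E(G))`. -/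
def edgeLattice : AddSubgroup (V → ℤ) :=
  AddSubgroup.closure (rho '' G.edges)

/-- The set `T₁` of the lattice points of `cone(P_G)` with respect to the edge lattice. -/
def ehrhartSemigroup : Set (V → ℤ) :=
  {a | realVec a ∈ Submodule.span NNReal G.edgePolytope ∧ a ∈ G.edgeLattice}

/-- The edge ring `k[G]`, generated over `k` by the monomials `x^ρ(e)`, `e ∈ E(G)`. -/
noncomputable def edgeRing (k : Type*) [Field k] : Subalgebra k (Laurent V k) :=
  Algebra.adjoin k ((fun e => laurentMonomial k (rho e)) '' G.edges)

/-- The Ehrhart ring `A(P_G) = k[T₁]`. -/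
noncomputable def ehrhartRing (k : Type*) [Field k] : Subalgebra k (Laurent V k) :=
  Algebra.adjoin k (laurentMonomial k '' G.ehrhartSemigroup)

/-- The cone over the edge polytope is the cone `ℝ₊ ρ(E(G))`. -/
theorem span_edgePolytope :
    Submodule.span NNReal G.edgePolytope =
      Submodule.span NNReal ((fun e => realVec (rho e)) '' G.edges) := by
  apply le_antisymm
  · rw [Submodule.span_le]
    refine convexHull_min Submodule.subset_span ?_
    intro x hx y hy a b ha hb _
    exact Submodule.add_mem _ (Submodule.smul_mem _ (⟨a, ha⟩ : NNReal) hx)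
      (Submodule.smul_mem _ (⟨b, hb⟩ : NNReal) hy)
  · exact Submodule.span_mono (subset_convexHull ℝ _)

end Rings

/-- Walks in a signed graph; each step records the signed edge that is used. -/
inductive Walk {V : Type*} (G : SignedGraph V) : V → V → Type _
  | nil (i : V) : Walk G i i
  | cons {i j l : V} (s : ℤˣ) (h : (s, s(i, j)) ∈ G.edges) (p : Walk G j l) : Walk G i l

namespace Walk

variable {V : Type*} {G : SignedGraph V}

/-- The vertices of a walk, in order. -/
def support : {i j : V} → G.Walk i j → List V
  | _, _, nil i => [i]
  | i, _, cons _ _ p => i :: p.support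

/-- The signed edges of a walk, in order. -/
def edges : {i j : V} → G.Walk i j → List (ℤˣ × Sym2 V)
  | _, _, nil _ => []
  | i, _, cons (j := j) s _ p => (s, s(i, j)) :: p.edges

/-- A path has no repeated vertex. -/
def IsPath {i j : V} (p : G.Walk i j) : Prop := p.support.Nodup

/-- Consecutive edges have opposite signs. -/
def IsAlternating {i j : V} (p : G.Walk i j) : Prop :=
  p.edges.IsChain fun e f => e.1 ≠ f.1

/-- An odd cycle: a closed walk of odd length in which no vertex (other than the coinciding
endpoints) and no edge is repeated.  A loop is an odd cycle of length one. -/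
def IsOddCycle {i : V} (c : G.Walk i i) : Prop :=
  Odd c.edges.length ∧ c.support.tail.Nodup ∧ c.edges.Nodup

/-- For a cycle `c`, the vector `½ ∑_{e ∈ c} ρ(e)`.  Its entry at a vertex `v` of `c` is the
signature of `v` in `c`, the average of the signs of the two edges of `c` at `v` (a loop counts
twice); its other entries are `0`.  The integer division is exact, see `two_mul_halfRho`. -/
def halfRho [DecidableEq V] {i : V} (c : G.Walk i i) : V → ℤ :=
  fun v => (c.edges.map rho).sum v / 2

theorem sum_rho_modEq [DecidableEq V] {i j : V} (p : G.Walk i j) (v : V) :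
    ((p.edges.map rho).sum v : ZMod 2) = ((Pi.single i 1 + Pi.single j 1 : V → ℤ) v : ZMod 2) := by
  induction p with
  | nil i =>
    simp only [edges, List.map_nil, List.sum_nil, Pi.zero_apply, Pi.add_apply, Int.cast_add]
    rw [CharTwo.add_self_eq_zero, Int.cast_zero]
  | @cons i j l s h p ih =>
    have hs : (((s : ℤˣ) : ℤ) : ZMod 2) = 1 := by
      rcases Int.units_eq_one_or s with rfl | rfl
      · simp
      · decide
    simp only [edges, List.map_cons, List.sum_cons, Pi.add_apply, Int.cast_add] at ih ⊢
    rw [ih]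
    simp only [rho, ends, Sym2.lift_mk, Pi.smul_apply, Pi.add_apply, smul_eq_mul, Int.cast_mul,
      Int.cast_add, hs, one_mul]
    linear_combination CharTwo.add_self_eq_zero ((Pi.single j 1 : V → ℤ) v : ZMod 2)

theorem two_mul_halfRho [DecidableEq V] {i : V} (c : G.Walk i i) :
    2 • c.halfRho = (c.edges.map rho).sum := by
  funext v
  have h := sum_rho_modEq c v
  rw [Pi.add_apply, Int.cast_add, CharTwo.add_self_eq_zero] at h
  have h2 : (2 : ℤ) ∣ (c.edges.map rho).sum v :=
    (ZMod.intCast_zmod_eq_zero_iff_dvd _ 2).1 h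
  simp only [halfRho, Pi.smul_apply, nsmul_eq_mul, Nat.cast_ofNat]
  exact Int.mul_ediv_cancel' h2

/-- An exceptional pair: two vertex-disjoint odd cycles in one component of `G` such that no
alternating path of `G` joins a vertex of the first to a vertex of the second. -/
def IsExceptionalPair {u w : V} (c : G.Walk u u) (c' : G.Walk w w) : Prop :=
  c.IsOddCycle ∧ c'.IsOddCycle ∧ c.support.Disjoint c'.support ∧ Nonempty (G.Walk u w) ∧
    ¬ ∃ i ∈ c.support, ∃ j ∈ c'.support, ∃ p : G.Walk i j, p.IsPath ∧ p.IsAlternating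

end Walk

/-- The monomials `M_Π = x^{½ρ(Π)}`, where `Π` runs over the exceptional pairs of `G`. -/
def exceptionalMonomials {V : Type*} [DecidableEq V] (G : SignedGraph V) (k : Type*) [Field k] :
    Set (Laurent V k) :=
  {m | ∃ (u w : V) (c : G.Walk u u) (c' : G.Walk w w),
    c.IsExceptionalPair c' ∧ m = laurentMonomial k (c.halfRho + c'.halfRho)}

end SignedGraph

/-! Everything reduces to exponents. The central fact is that `a` lies in the Ehrhart semigroup iff
`a` is in the edge lattice and `2a` is a sum of vectors `ρ(e)` (`mem_ehrhartSemigroup_iff`). By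
Carathéodory, `a` is a nonnegative combination of linearly independent edge vectors. Twice any
integer vector in the real span of a set of edges lies in their lattice
(`two_nsmul_mem_edgeLattice`), and by independence the resulting integer coefficients are twice the
real ones, hence nonnegative.

If `2a` is a sum over a multiset of edges, every vertex has even degree, so the multiset splits into
closed walks, and `a` is the sum of their halves. Half an even closed walk is a sum of edges; half
an odd one reduces to edges and halves of odd cycles (`mem_closure_of_two_nsmul_eq`). When `a` is in
the lattice, each component contains an even number of these cycles, so they can be paired. A pair
that meets or is joined by an alternating path again gives a sum of edges; every other pair is
exceptional (`sum_mem_closure_of_mem_edgeLattice`). This yields the generators.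

For normality, the square of each monomial of the Ehrhart ring lies in the edge ring. Conversely, an
element of the normalization is a Laurent polynomial, since the Laurent ring is integrally closed;
weight valuations and Farkas' lemma force its exponents into the cone, and being a quotient of edge
ring elements forces them into the lattice. -/

namespace SignedGraph

/-- The affine semigroup `ℕ ρ(E(G))`. -/
def edgeSemigroup {V : Type*} [DecidableEq V] (G : SignedGraph V) : AddSubmonoid (V → ℤ) :=
  AddSubmonoid.closure (rho '' G.edges)

theorem two_nsmul_injective {V : Type*} {a b : V → ℤ} (h : 2 • a = 2 • b) : a = b :=
  smul_right_injective _ two_ne_zero h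

/-! ### The edge semigroup inside the edge lattice. -/

section Semigroup

variable {V : Type*} [DecidableEq V] {G : SignedGraph V}

theorem rho_mem_edgeSemigroup {e : ℤˣ × Sym2 V} (h : e ∈ G.edges) : rho e ∈ G.edgeSemigroup :=
  AddSubmonoid.subset_closure ⟨e, h, rfl⟩

theorem rho_mem_edgeLattice {e : ℤˣ × Sym2 V} (h : e ∈ G.edges) : rho e ∈ G.edgeLattice :=
  AddSubgroup.subset_closure ⟨e, h, rfl⟩

theorem edgeSemigroup_le_edgeLattice : G.edgeSemigroup ≤ G.edgeLattice.toAddSubmonoid :=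
  AddSubmonoid.closure_le.2 fun _ ⟨_, he, h⟩ => h ▸ rho_mem_edgeLattice he

theorem rho_mk (s : ℤˣ) (i j : V) :
    rho (s, s(i, j)) = (s : ℤ) • (Pi.single i 1 + Pi.single j 1 : V → ℤ) := rfl

theorem exists_multiset_of_mem_edgeSemigroup {a : V → ℤ} (h : a ∈ G.edgeSemigroup) :
    ∃ m : Multiset (ℤˣ × Sym2 V), (∀ e ∈ m, e ∈ G.edges) ∧ a = (m.map rho).sum := by
  induction h using AddSubmonoid.closure_induction with
  | mem x hx =>
    obtain ⟨e, he, rfl⟩ := hx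
    exact ⟨{e}, by simpa using he, by simp⟩
  | zero => exact ⟨0, by simp, by simp⟩
  | add x y _ _ hx hy =>
    obtain ⟨m, hm, rfl⟩ := hx
    obtain ⟨n, hn, rfl⟩ := hy
    refine ⟨m + n, fun e he => ?_, by simp⟩
    exact (Multiset.mem_add.1 he).elim (hm e) (hn e)

end Semigroup

/-! ### Walks, closed walks and their half-sums. -/

namespace Walk

variable {V : Type*} {G : SignedGraph V}

theorem start_mem_support {i j : V} (p : G.Walk i j) : i ∈ p.support := by
  cases p <;> simp [support]

theorem end_mem_support {i j : V} (p : G.Walk i j) : j ∈ p.support := by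
  induction p with
  | nil i => simp [support]
  | cons s h p ih => simp [support, ih]

theorem exists_append {i j l : V} (p : G.Walk i j) (q : G.Walk j l) :
    ∃ r : G.Walk i l, r.edges = p.edges ++ q.edges := by
  induction p with
  | nil i => exact ⟨q, rfl⟩
  | cons s h p ih =>
    obtain ⟨r, hr⟩ := ih q
    exact ⟨cons s h r, by simp [edges, hr]⟩

theorem mem_edges {i j : V} (p : G.Walk i j) : ∀ e ∈ p.edges, e ∈ G.edges := by
  induction p with
  | nil i => simp [edges]
  | cons s h p ih =>
    intro e he
    rcases List.mem_cons.1 he with rfl | he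
    exacts [h, ih e he]

theorem mem_support_of_mem_edges {i j : V} (p : G.Walk i j) {e : ℤˣ × Sym2 V}
    (he : e ∈ p.edges) {v : V} (hv : v ∈ e.2) : v ∈ p.support := by
  induction p with
  | nil i => simp [edges] at he
  | cons s h p ih =>
    rcases List.mem_cons.1 he with rfl | he
    · rcases Sym2.mem_iff.1 hv with rfl | rfl
      · exact List.mem_cons_self
      · exact List.mem_cons_of_mem _ p.start_mem_support
    · exact List.mem_cons_of_mem _ (ih he)

theorem exists_split {i j : V} (p : G.Walk i j) {v : V} (hv : v ∈ p.support) :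
    ∃ (q : G.Walk i v) (r : G.Walk v j), p.edges = q.edges ++ r.edges := by
  induction p with
  | nil i =>
    obtain rfl : v = i := by simpa [support] using hv
    exact ⟨nil _, nil _, rfl⟩
  | cons s h p ih =>
    rcases List.mem_cons.1 hv with rfl | hv
    · exact ⟨nil _, cons s h p, rfl⟩
    · obtain ⟨q, r, hqr⟩ := ih hv
      exact ⟨cons s h q, r, by simp [edges, hqr]⟩

theorem exists_closed_of_not_isPath {i j : V} (p : G.Walk i j) (hp : ¬ p.IsPath) :
    ∃ (v : V) (q : G.Walk i v) (r : G.Walk v v) (t : G.Walk v j),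
      p.edges = q.edges ++ (r.edges ++ t.edges) ∧ r.edges ≠ [] := by
  induction p with
  | nil i => simp [IsPath, support] at hp
  | @cons i j l s h p ih =>
    by_cases hi : i ∈ p.support
    · obtain ⟨q, r, hqr⟩ := p.exists_split hi
      exact ⟨i, nil i, cons s h q, r, by simp [edges, hqr], by simp [edges]⟩
    · obtain ⟨v, q, r, t, he, hr⟩ := ih fun h' => hp (List.nodup_cons.2 ⟨hi, h'⟩)
      exact ⟨v, cons s h q, r, t, by simp [edges, he], hr⟩

theorem IsPath.edges_nodup {i j : V} {p : G.Walk i j} (hp : p.IsPath) : p.edges.Nodup := by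
  induction p with
  | nil i => simp [edges]
  | cons s h p ih =>
    obtain ⟨hi, hp⟩ := List.nodup_cons.1 hp
    exact List.nodup_cons.2
      ⟨fun he => hi (p.mem_support_of_mem_edges he (Sym2.mem_mk_left _ _)), ih hp⟩

theorem IsPath.edges_eq_nil {i : V} {p : G.Walk i i} (hp : p.IsPath) : p.edges = [] := by
  cases p with
  | nil => rfl
  | cons s h p => exact absurd p.end_mem_support (List.nodup_cons.1 hp).1

theorem IsPath.length_edges_eq_one {i j : V} {p : G.Walk j i} (hp : p.IsPath) {s : ℤˣ}
    (h : (s, s(i, j)) ∈ p.edges) : p.edges.length = 1 := by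
  cases p with
  | nil => simp [edges] at h
  | @cons _ x _ s' h' p =>
    obtain ⟨hj, hp⟩ := List.nodup_cons.1 hp
    rcases List.mem_cons.1 h with h | h
    · have hx : x = i := by
        have h2 := (Prod.ext_iff.1 h).2
        rcases Sym2.eq_iff.1 h2 with ⟨rfl, rfl⟩ | ⟨h3, -⟩
        · rfl
        · exact h3.symm
      subst hx
      simp [edges, IsPath.edges_eq_nil hp]
    · exact absurd (p.mem_support_of_mem_edges h (Sym2.mem_mk_right _ _)) hj

/-- Distinct vertices already force distinct edges: if the first edge recurred on the path back,
that path would have length one and the cycle length two, which is even. -/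
theorem isOddCycle_of_tail_nodup {i : V} (c : G.Walk i i) (hc : Odd c.edges.length)
    (h : c.support.tail.Nodup) : c.IsOddCycle := by
  refine ⟨hc, h, ?_⟩
  cases c with
  | nil => simp [edges]
  | cons s hs p =>
    refine List.nodup_cons.2 ⟨fun he => ?_, IsPath.edges_nodup h⟩
    have := IsPath.length_edges_eq_one h he
    rw [edges, List.length_cons, this] at hc
    exact absurd hc (by decide)

section Rho

variable [DecidableEq V]

/-- The vector `σ(e_i - (-1)^n e_j)` telescopes into the edges of the walk taken with alternating
signs. Where the alternating sign agrees with the sign of the edge, the two terms add to `2ρ(e)`;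
where it disagrees they cancel. All later facts on half-sums come from this identity, with `σ` free.
-/
theorem exists_sum_rho_add {i j : V} (p : G.Walk i j) (σ : ℤˣ) :
    ∃ b ∈ G.edgeSemigroup, (p.edges.map rho).sum +
      (σ : ℤ) • (Pi.single i 1 - (-1) ^ p.edges.length • Pi.single j 1 : V → ℤ) = 2 • b := by
  induction p generalizing σ with
  | nil i => exact ⟨0, zero_mem _, by simp [edges]⟩
  | @cons i j l s h p ih =>
    obtain ⟨b, hb, hpb⟩ := ih (-σ)
    obtain ⟨d, hd, hsd⟩ : ∃ d ∈ G.edgeSemigroup, rho (s, s(i, j)) +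
        (σ : ℤ) • (Pi.single i 1 + Pi.single j 1 : V → ℤ) = 2 • d := by
      rcases Int.units_eq_one_or (s * σ) with h1 | h1
      · obtain rfl : s = σ := by simpa using mul_eq_one_iff_eq_inv.1 h1
        exact ⟨_, rho_mem_edgeSemigroup h, by rw [rho_mk, two_nsmul]⟩
      · obtain rfl : s = -σ := by
          rw [← mul_left_inj σ, h1]; simp
        exact ⟨0, zero_mem _, by rw [rho_mk]; push_cast; module⟩
    refine ⟨d + b, add_mem hd hb, ?_⟩
    rw [smul_add, ← hsd, ← hpb]
    simp only [edges, List.map_cons, List.sum_cons, List.length_cons, pow_succ]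
    push_cast
    module

theorem sum_rho_mem_edgeSemigroup {i j : V} (p : G.Walk i j) :
    (p.edges.map rho).sum ∈ G.edgeSemigroup :=
  AddSubmonoid.list_sum_mem _ fun _ hx => by
    obtain ⟨e, he, rfl⟩ := List.mem_map.1 hx
    exact rho_mem_edgeSemigroup (p.mem_edges e he)

theorem sum_rho_mem_edgeLattice {i j : V} (p : G.Walk i j) :
    (p.edges.map rho).sum ∈ G.edgeLattice :=
  edgeSemigroup_le_edgeLattice p.sum_rho_mem_edgeSemigroup

theorem exists_single_sub_mem_edgeLattice {i j : V} (p : G.Walk i j) :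
    ∃ σ : ℤˣ, (Pi.single i 1 - (σ : ℤ) • Pi.single j 1 : V → ℤ) ∈ G.edgeLattice := by
  obtain ⟨b, hb, h⟩ := p.exists_sum_rho_add 1
  refine ⟨(-1) ^ p.edges.length, ?_⟩
  have : (Pi.single i 1 - (((-1) ^ p.edges.length : ℤˣ) : ℤ) • Pi.single j 1 : V → ℤ)
      = 2 • b - (p.edges.map rho).sum := by
    rw [← h]; push_cast; module
  rw [this]
  exact sub_mem (nsmul_mem (edgeSemigroup_le_edgeLattice hb) 2) p.sum_rho_mem_edgeLattice

theorem halfRho_mem_of_even {i : V} (c : G.Walk i i) (hc : Even c.edges.length) :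
    c.halfRho ∈ G.edgeSemigroup := by
  obtain ⟨b, hb, h⟩ := c.exists_sum_rho_add 1
  rw [hc.neg_one_pow, one_smul, sub_self, smul_zero, add_zero, ← two_mul_halfRho] at h
  rwa [two_nsmul_injective h]

theorem halfRho_congr {i j : V} {c : G.Walk i i} {c' : G.Walk j j}
    (h : (c.edges.map rho).sum = (c'.edges.map rho).sum) : c.halfRho = c'.halfRho :=
  two_nsmul_injective (by rw [two_mul_halfRho, two_mul_halfRho, h])

theorem halfRho_add_start_mem {i : V} (c : G.Walk i i) (hc : Odd c.edges.length) (σ : ℤˣ) :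
    c.halfRho + (σ : ℤ) • Pi.single i 1 ∈ G.edgeSemigroup := by
  obtain ⟨b, hb, h⟩ := c.exists_sum_rho_add σ
  rw [hc.neg_one_pow, ← two_mul_halfRho] at h
  convert hb
  refine two_nsmul_injective ?_
  rw [← h]
  module

/-- The walk is rotated to start at `v`; its half-sum does not depend on the starting point. -/
theorem halfRho_add_single_mem {i v : V} (c : G.Walk i i) (hc : Odd c.edges.length)
    (hv : v ∈ c.support) (σ : ℤˣ) :
    c.halfRho + (σ : ℤ) • Pi.single v 1 ∈ G.edgeSemigroup := by
  obtain ⟨q, r, hqr⟩ := c.exists_split hv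
  obtain ⟨c', hc'⟩ := exists_append r q
  have : c.halfRho = c'.halfRho := halfRho_congr (by simp [hqr, hc', add_comm])
  rw [this]
  refine c'.halfRho_add_start_mem ?_ σ
  simpa [hqr, hc', add_comm] using hc

/-- At each interior vertex the two opposite signs cancel, so only the two ends survive. -/
theorem IsAlternating.sum_rho {i j : V} {p : G.Walk i j} (hp : p.IsAlternating) {s : ℤˣ}
    {e : Sym2 V} {l : List (ℤˣ × Sym2 V)} (hl : p.edges = (s, e) :: l) :
    ∃ t : ℤˣ, (p.edges.map rho).sum =
      ((s : ℤ) • Pi.single i 1 + (t : ℤ) • Pi.single j 1 : V → ℤ) := by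
  induction p generalizing s e l with
  | nil i => simp [edges] at hl
  | @cons i j k s' h p ih =>
    obtain rfl : s' = s := (Prod.ext_iff.1 (List.cons.inj hl).1).1
    rcases hpe : p.edges with - | ⟨⟨t, f⟩, l'⟩
    · cases p with
      | nil => exact ⟨s', by simp [edges, rho_mk]⟩
      | cons => simp [edges] at hpe
    · have hch : List.IsChain (fun e f : ℤˣ × Sym2 V => e.1 ≠ f.1)
          ((s', s(i, j)) :: (t, f) :: l') := by
        have := hp
        rwa [IsAlternating, edges, hpe] at this
      obtain ⟨hst, hch⟩ := List.isChain_cons_cons.1 hch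
      have hpa : p.IsAlternating := by rwa [IsAlternating, hpe]
      obtain ⟨u, hu⟩ := ih hpa hpe
      refine ⟨u, ?_⟩
      have hts : t = -s' := by
        rcases Int.units_eq_one_or s' with rfl | rfl <;>
          rcases Int.units_eq_one_or t with rfl | rfl <;> simp_all
      rw [edges, List.map_cons, List.sum_cons, hu, rho_mk, hts]
      push_cast
      module

end Rho

end Walk
end SignedGraph

/-! ### Splitting half-sums into edges, odd cycles and exceptional pairs. -/

namespace SignedGraph

theorem add_self_zmod2 {V : Type*} (x : V → ZMod 2) : x + x = 0 := by
  funext v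
  exact CharTwo.add_self_eq_zero _

theorem walk_nonempty_iff {V : Type*} {G : SignedGraph V} {i j w : V} {s : ℤˣ}
    (h : (s, s(i, j)) ∈ G.edges) :
    Nonempty (G.Walk w i) ↔ Nonempty (G.Walk w j) := by
  constructor
  · rintro ⟨p⟩
    exact (p.exists_append (.cons s h (.nil _))).nonempty
  · rintro ⟨p⟩
    exact (p.exists_append (.cons s (Sym2.eq_swap ▸ h) (.nil _))).nonempty

variable {V : Type*} [DecidableEq V] {G : SignedGraph V}

/-- The vectors `½ ρ(C)` of the odd cycles `C`. -/
def oddCycleVectors (G : SignedGraph V) : Set (V → ℤ) :=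
  {a | ∃ (u : V) (c : G.Walk u u), c.IsOddCycle ∧ a = c.halfRho}

/-- The vectors `½ ρ(Π)` of the exceptional pairs `Π`. -/
def exceptionalVectors (G : SignedGraph V) : Set (V → ℤ) :=
  {a | ∃ (u w : V) (c : G.Walk u u) (c' : G.Walk w w),
    c.IsExceptionalPair c' ∧ a = c.halfRho + c'.halfRho}

namespace Walk

theorem halfRho_mem_of_split {i j : V} {c : G.Walk i i} {q : G.Walk i i} {r : G.Walk j j}
    (h : (c.edges.map rho).sum = (q.edges.map rho).sum + (r.edges.map rho).sum)
    {S : AddSubmonoid (V → ℤ)} (hq : q.halfRho ∈ S) (hr : r.halfRho ∈ S) : c.halfRho ∈ S := by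
  have : c.halfRho = q.halfRho + r.halfRho := two_nsmul_injective (by
    rw [smul_add, two_mul_halfRho, two_mul_halfRho, two_mul_halfRho, h])
  rw [this]
  exact add_mem hq hr

/-- Even closed walks are sums of edges. An odd closed walk that is not a cycle repeats a vertex,
where it splits into two shorter closed walks. -/
theorem halfRho_mem_closure {i : V} (c : G.Walk i i) :
    c.halfRho ∈ AddSubmonoid.closure (rho '' G.edges ∪ G.oddCycleVectors) := by
  obtain ⟨n, hn⟩ : ∃ n, c.edges.length = n := ⟨_, rfl⟩
  induction n using Nat.strong_induction_on generalizing i with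
  | _ n ih =>
    subst hn
    rcases Nat.even_or_odd c.edges.length with he | ho
    · exact AddSubmonoid.closure_mono Set.subset_union_left (c.halfRho_mem_of_even he)
    by_cases ht : c.support.tail.Nodup
    · exact AddSubmonoid.subset_closure
        (Or.inr ⟨i, c, c.isOddCycle_of_tail_nodup ho ht, rfl⟩)
    cases c with
    | nil => simp [edges] at ho
    | cons s h p =>
      obtain ⟨v, q, r, t, hp, hr⟩ := p.exists_closed_of_not_isPath ht
      -- The rest of the walk after `r` is cut out. It keeps the first edge, so `r` is strictly
      -- shorter too.
      obtain ⟨d, hd⟩ := exists_append (cons s h q) t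
      have hrl : 0 < r.edges.length := List.length_pos_iff.2 hr
      refine halfRho_mem_of_split (q := d) (r := r) ?_
        (ih _ ?_ d rfl) (ih _ ?_ r rfl)
      · simp [edges, hp, hd, List.sum_append]
        abel
      · simp [edges, hp, hd]
        omega
      · simp [edges, hp]
        omega

end Walk

/-- A vector reduced modulo `2`. -/
def mod2 (V : Type*) : (V → ℤ) →+ (V → ZMod 2) :=
  (Int.castAddHom (ZMod 2)).compLeft V

theorem mod2_single (v : V) (n : ℤ) : mod2 V (Pi.single v n) = Pi.single v (n : ZMod 2) := by
  funext w
  by_cases h : w = v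
  · subst h; simp [mod2]
  · simp [mod2, h]

theorem mod2_rho (s : ℤˣ) (i j : V) :
    mod2 V (rho (s, s(i, j))) = Pi.single i 1 + Pi.single j 1 := by
  rw [rho_mk]
  rcases Int.units_eq_one_or s with rfl | rfl
  · simp [mod2_single]
  · rw [Units.val_neg, Units.val_one, neg_one_zsmul, map_neg, map_add, mod2_single, mod2_single,
      Int.cast_one, neg_eq_iff_add_eq_zero]
    exact add_self_zmod2 _

/-- Greedy trail: while `u ≠ w`, the degree at `u` is odd, so some non-loop edge leaves `u`; use it
up and continue from its other end. -/
theorem exists_walk_of_parity (m : Multiset (ℤˣ × Sym2 V)) (hm : ∀ e ∈ m, e ∈ G.edges)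
    (u w : V) (h : mod2 V (m.map rho).sum = Pi.single u 1 + Pi.single w 1) :
    ∃ (p : G.Walk u w) (m' : Multiset (ℤˣ × Sym2 V)), m = ↑p.edges + m' := by
  induction hn : m.card generalizing m u with
  | zero =>
    obtain rfl := Multiset.card_eq_zero.1 hn
    obtain rfl : u = w := by
      by_contra huw
      have := congrFun h u
      simp [huw] at this
    exact ⟨Walk.nil u, 0, by simp [Walk.edges]⟩
  | succ n ih =>
    by_cases huw : u = w
    · subst huw
      exact ⟨Walk.nil u, m, by simp [Walk.edges]⟩
    obtain ⟨e, he, heu⟩ : ∃ e ∈ m, mod2 V (rho e) u ≠ 0 := by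
      by_contra! hcon
      have h1 := congrArg (Pi.evalAddMonoidHom (fun _ : V => ZMod 2) u) h
      rw [map_multiset_sum, Multiset.map_map, map_multiset_sum, Multiset.map_map,
        Multiset.sum_eq_zero] at h1
      · simp [huw] at h1
      · intro x hx
        obtain ⟨e, he, rfl⟩ := Multiset.mem_map.1 hx
        exact hcon e he
    obtain ⟨s, f⟩ := e
    obtain ⟨x, rfl⟩ : ∃ x, f = s(u, x) := by
      induction f using Sym2.ind with
      | _ a b =>
        rw [mod2_rho] at heu
        by_cases ha : u = a
        · exact ⟨b, by rw [ha]⟩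
        by_cases hb : u = b
        · exact ⟨a, by rw [hb, Sym2.eq_swap]⟩
        simp [ha, hb] at heu
    obtain ⟨m1, rfl⟩ := Multiset.exists_cons_of_mem he
    have hx : mod2 V (m1.map rho).sum = Pi.single x 1 + Pi.single w 1 := by
      rw [Multiset.map_cons, Multiset.sum_cons, map_add, mod2_rho] at h
      have := add_self_zmod2 (Pi.single x 1 : V → ZMod 2)
      linear_combination (exp := 1) h - this
    obtain ⟨p, m', rfl⟩ := ih m1 (fun e he => hm e (Multiset.mem_cons_of_mem he)) x hx
      (by simpa using hn)
    exact ⟨Walk.cons s (hm _ (Multiset.mem_cons_self _ _)) p, m', by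
      simp [Walk.edges, ← Multiset.cons_coe]⟩

theorem mem_closure_of_two_nsmul_eq (m : Multiset (ℤˣ × Sym2 V)) (hm : ∀ e ∈ m, e ∈ G.edges)
    {a : V → ℤ} (ha : 2 • a = (m.map rho).sum) :
    a ∈ AddSubmonoid.closure (rho '' G.edges ∪ G.oddCycleVectors) := by
  obtain ⟨n, hn⟩ : ∃ n, m.card = n := ⟨_, rfl⟩
  induction n using Nat.strong_induction_on generalizing m a with
  | _ n ih =>
    subst hn
    rcases m.empty_or_exists_mem with rfl | ⟨⟨s, f⟩, he⟩
    · have : a = 0 := two_nsmul_injective (by simpa using ha)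
      rw [this]
      exact zero_mem _
    induction f using Sym2.ind with
    | _ u x =>
    obtain ⟨m1, rfl⟩ := Multiset.exists_cons_of_mem he
    -- With the edge `ux` removed from an even multiset, exactly the parities at `x` and `u` change,
    -- so a trail leads from `x` back to `u` and closes up.
    have hx : mod2 V (m1.map rho).sum = Pi.single x 1 + Pi.single u 1 := by
      have h := congrArg (mod2 V) ha
      rw [Multiset.map_cons, Multiset.sum_cons, map_add, mod2_rho, two_nsmul, map_add,
        add_self_zmod2] at h
      have h1 := add_self_zmod2 (Pi.single x 1 : V → ZMod 2)
      have h2 := add_self_zmod2 (Pi.single u 1 : V → ZMod 2)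
      linear_combination (exp := 1) - h - h1 - h2
    obtain ⟨p, m', rfl⟩ := exists_walk_of_parity m1
      (fun e he => hm e (Multiset.mem_cons_of_mem he)) x u hx
    let c := Walk.cons s (hm _ (Multiset.mem_cons_self _ _)) p
    have hc : a = c.halfRho + (a - c.halfRho) := by abel
    rw [hc]
    refine add_mem c.halfRho_mem_closure (ih m'.card ?_ m' (fun e he => hm e ?_) ?_ rfl)
    · simp
    · simp [he]
    · rw [smul_sub, ha, Walk.two_mul_halfRho]
      simp [c, Walk.edges]

open Classical in
/-- The sum modulo `2` of the entries of a vector over the component of `u`. -/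
noncomputable def componentParity [Fintype V] (G : SignedGraph V) (u : V) :
    (V → ℤ) →+ ZMod 2 where
  toFun a := ∑ v, if Nonempty (G.Walk u v) then (a v : ZMod 2) else 0
  map_zero' := by simp
  map_add' a b := by
    rw [← Finset.sum_add_distrib]
    refine Finset.sum_congr rfl fun v _ => ?_
    split_ifs <;> simp

open Classical in
theorem componentParity_single [Fintype V] (u v : V) :
    G.componentParity u (Pi.single v 1) = if Nonempty (G.Walk u v) then 1 else 0 := by
  change (∑ x, if Nonempty (G.Walk u x) then (((Pi.single v 1 : V → ℤ) x : ℤ) : ZMod 2) else 0) = _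
  rw [Finset.sum_eq_single v]
  · simp
  · intro x _ hx
    simp [hx]
  · simp

theorem componentParity_eq_zero [Fintype V] (u : V) {a : V → ℤ} (ha : a ∈ G.edgeLattice) :
    G.componentParity u a = 0 := by
  induction ha using AddSubgroup.closure_induction with
  | mem x hx =>
    obtain ⟨⟨s, f⟩, he, rfl⟩ := hx
    induction f using Sym2.ind with
    | _ i j =>
      rw [rho_mk, map_zsmul, map_add, componentParity_single, componentParity_single,
        walk_nonempty_iff he, CharTwo.add_self_eq_zero, smul_zero]
  | zero => exact map_zero _
  | add x y _ _ hx hy => rw [map_add, hx, hy, add_zero]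
  | neg x _ hx => rw [map_neg, hx, neg_zero]

-- Subtracting `e_v` from the half-sum leaves a lattice vector, which has even component sums; so an
-- odd cycle counts once, in its own component.
open Classical in
theorem componentParity_halfRho [Fintype V] (u : V) {v : V} (c : G.Walk v v)
    (hc : Odd c.edges.length) :
    G.componentParity u c.halfRho = if Nonempty (G.Walk u v) then 1 else 0 := by
  have h := componentParity_eq_zero u
    (edgeSemigroup_le_edgeLattice (c.halfRho_add_start_mem hc (-1)))
  rw [map_add, map_zsmul, componentParity_single] at h
  rw [Units.val_neg, Units.val_one, neg_one_zsmul, ← sub_eq_add_neg, sub_eq_zero] at h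
  exact h

namespace Walk

theorem halfRho_add_halfRho_mem_edgeLattice {u w : V} (c : G.Walk u u) (c' : G.Walk w w)
    (hc : Odd c.edges.length) (hc' : Odd c'.edges.length) (p : G.Walk u w) :
    c.halfRho + c'.halfRho ∈ G.edgeLattice := by
  obtain ⟨σ, hσ⟩ := p.exists_single_sub_mem_edgeLattice
  have h1 := edgeSemigroup_le_edgeLattice (c.halfRho_add_start_mem hc (-1))
  have h2 := edgeSemigroup_le_edgeLattice (c'.halfRho_add_start_mem hc' σ)
  rw [AddSubgroup.mem_toAddSubmonoid] at h1 h2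
  convert add_mem (add_mem h1 h2) hσ using 1
  push_cast
  module

/-- Half-sums of odd cycles absorb `±e_v` at any of their vertices. At a common vertex `e_v` and
`-e_v` cancel; along an alternating path with end contributions `s e_i + t e_j`, the cycles absorb
`-s e_i` and `-t e_j`. -/
theorem halfRho_add_halfRho_mem_closure {u w : V} {c : G.Walk u u} {c' : G.Walk w w}
    (hc : c.IsOddCycle) (hc' : c'.IsOddCycle) (p : G.Walk u w) :
    c.halfRho + c'.halfRho ∈ AddSubmonoid.closure (rho '' G.edges ∪ G.exceptionalVectors) := by
  have hle : G.edgeSemigroup ≤ AddSubmonoid.closure (rho '' G.edges ∪ G.exceptionalVectors) :=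
    AddSubmonoid.closure_mono Set.subset_union_left
  by_cases hd : c.support.Disjoint c'.support
  swap
  · obtain ⟨v, hv, hv'⟩ : ∃ v ∈ c.support, v ∈ c'.support := by
      simpa [List.Disjoint] using hd
    refine hle ?_
    convert add_mem (c.halfRho_add_single_mem hc.1 hv 1) (c'.halfRho_add_single_mem hc'.1 hv' (-1))
      using 1
    push_cast
    module
  by_cases ha : ∃ i ∈ c.support, ∃ j ∈ c'.support, ∃ p : G.Walk i j, p.IsPath ∧ p.IsAlternating
  · obtain ⟨i, hi, j, hj, q, -, hq⟩ := ha
    refine hle ?_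
    rcases hqe : q.edges with - | ⟨⟨s, e⟩, l⟩
    · cases q with
      | nil => exact absurd hj (hd hi)
      | cons => simp [edges] at hqe
    · obtain ⟨t, ht⟩ := hq.sum_rho hqe
      have hqs := q.sum_rho_mem_edgeSemigroup
      rw [ht] at hqs
      convert add_mem (add_mem (c.halfRho_add_single_mem hc.1 hi (-s))
        (c'.halfRho_add_single_mem hc'.1 hj (-t))) hqs using 1
      push_cast
      module
  · exact AddSubmonoid.subset_closure (Or.inr ⟨u, w, c, c', ⟨hc, hc', hd, ⟨p⟩, ha⟩, rfl⟩)

end Walk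

theorem sum_mem_closure_of_mem_edgeLattice [Finite V] (l : Multiset (V → ℤ))
    (hl : ∀ x ∈ l, x ∈ G.oddCycleVectors) (hL : l.sum ∈ G.edgeLattice) :
    l.sum ∈ AddSubmonoid.closure (rho '' G.edges ∪ G.exceptionalVectors) := by
  classical
  have := Fintype.ofFinite V
  obtain ⟨n, hn⟩ : ∃ n, l.card = n := ⟨_, rfl⟩
  induction n using Nat.strong_induction_on generalizing l with
  | _ n ih =>
    subst hn
    rcases l.empty_or_exists_mem with rfl | ⟨x, hx⟩
    · simp
    obtain ⟨l, rfl⟩ := Multiset.exists_cons_of_mem hx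
    obtain ⟨u, c, hc, rfl⟩ := hl x hx
    -- Without a partner in its component, the cycle at `u` would make the component parity of the
    -- lattice vector equal to 1.
    obtain ⟨w, c', hc', hmem, p⟩ : ∃ (w : V) (c' : G.Walk w w),
        c'.IsOddCycle ∧ c'.halfRho ∈ l ∧ Nonempty (G.Walk u w) := by
      by_contra! hcon
      have h := componentParity_eq_zero u hL
      rw [Multiset.sum_cons, map_add, componentParity_halfRho u c hc.1, if_pos ⟨Walk.nil u⟩,
        map_multiset_sum, Multiset.sum_eq_zero] at h
      · simp at h
      · intro y hy
        obtain ⟨z, hz, rfl⟩ := Multiset.mem_map.1 hy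
        obtain ⟨w, c', hc', rfl⟩ := hl z (Multiset.mem_cons_of_mem hz)
        rw [componentParity_halfRho u c' hc'.1, if_neg]
        rw [not_nonempty_iff]
        exact hcon w c' hc' hz
    obtain ⟨p⟩ := p
    obtain ⟨l, rfl⟩ := Multiset.exists_cons_of_mem hmem
    rw [Multiset.sum_cons, Multiset.sum_cons, ← add_assoc] at hL ⊢
    refine add_mem (Walk.halfRho_add_halfRho_mem_closure hc hc' p) (ih l.card ?_ l ?_ ?_ rfl)
    · simp
    · exact fun x hx => hl x (Multiset.mem_cons_of_mem (Multiset.mem_cons_of_mem hx))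
    · exact (add_mem_cancel_left
        (Walk.halfRho_add_halfRho_mem_edgeLattice c c' hc.1 hc'.1 p)).1 hL

theorem mem_closure_exceptionalVectors [Finite V] {a : V → ℤ} (hL : a ∈ G.edgeLattice)
    (ha : 2 • a ∈ G.edgeSemigroup) :
    a ∈ AddSubmonoid.closure (rho '' G.edges ∪ G.exceptionalVectors) := by
  obtain ⟨m, hm, hma⟩ := exists_multiset_of_mem_edgeSemigroup ha
  have h := mem_closure_of_two_nsmul_eq m hm hma
  rw [AddSubmonoid.closure_union, AddSubmonoid.mem_sup] at h
  obtain ⟨b, hb, d, hd, rfl⟩ := h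
  obtain ⟨l, hl, rfl⟩ := AddSubmonoid.exists_multiset_of_mem_closure hd
  refine add_mem (AddSubmonoid.closure_mono Set.subset_union_left hb)
    (sum_mem_closure_of_mem_edgeLattice l hl ?_)
  have hbL : b ∈ G.edgeLattice := edgeSemigroup_le_edgeLattice hb
  exact (add_mem_cancel_left hbL).1 hL

end SignedGraph

/-! ### Finitely generated real cones: Carathéodory, closedness, Farkas. -/

section Cone

variable {ι E : Type*} [AddCommGroup E] [Module ℝ E] {v : ι → E}

theorem exists_nonneg_erase_of_not_linearIndepOn [DecidableEq ι] {t : Finset ι} {c : ι → ℝ}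
    (hc : ∀ i ∈ t, 0 ≤ c i) (ht : ¬ LinearIndepOn ℝ v (t : Set ι)) :
    ∃ i ∈ t, ∃ c' : ι → ℝ, (∀ i ∈ t, 0 ≤ c' i) ∧
      ∑ j ∈ t.erase i, c' j • v j = ∑ j ∈ t, c j • v j := by
  obtain ⟨g, hg, i, hi, hgi⟩ : ∃ g : ι → ℝ, ∑ i ∈ t, g i • v i = 0 ∧ ∃ i ∈ t, 0 < g i := by
    rw [linearIndepOn_finset_iff] at ht
    push Not at ht
    obtain ⟨g, hg, i, hi, hgi⟩ := ht
    rcases hgi.lt_or_gt with h | h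
    · exact ⟨-g, by simp [hg], i, hi, by simpa using h⟩
    · exact ⟨g, hg, i, hi, h⟩
  -- The least ratio is the longest step along the relation `g` that keeps every coefficient
  -- nonnegative; the coefficient of its minimizer `j` becomes 0.
  obtain ⟨j, hj, hmin⟩ := (t.filter fun i => 0 < g i).exists_min_image (fun i => c i / g i)
    ⟨i, by simp [hi, hgi]⟩
  obtain ⟨hjt, hgj⟩ := Finset.mem_filter.1 hj
  refine ⟨j, hjt, fun i => c i - c j / g j * g i, fun i hi => ?_, ?_⟩
  · rcases lt_or_ge 0 (g i) with h | h
    · have := hmin i (by simp [hi, h])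
      rw [le_div_iff₀ h] at this
      linarith
    · have := mul_nonpos_of_nonneg_of_nonpos (div_nonneg (hc j hjt) hgj.le) h
      linarith [hc i hi]
  · rw [Finset.sum_erase _ (by beta_reduce; rw [div_mul_cancel₀ _ hgj.ne', sub_self, zero_smul])]
    simp only [sub_smul, mul_smul, Finset.sum_sub_distrib, ← Finset.smul_sum, hg, smul_zero,
      sub_zero]

/-- Carathéodory's theorem for cones. -/
theorem exists_linearIndepOn_of_nonneg (t : Finset ι) (c : ι → ℝ) (hc : ∀ i ∈ t, 0 ≤ c i) :
    ∃ t' ⊆ t, LinearIndepOn ℝ v (t' : Set ι) ∧ ∃ c' : ι → ℝ, (∀ i ∈ t', 0 ≤ c' i) ∧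
      ∑ i ∈ t', c' i • v i = ∑ i ∈ t, c i • v i := by
  classical
  induction t using Finset.strongInduction generalizing c with
  | H t ih =>
    by_cases ht : LinearIndepOn ℝ v (t : Set ι)
    · exact ⟨t, subset_rfl, ht, c, hc, rfl⟩
    obtain ⟨i, hi, c', hc', hsum⟩ := exists_nonneg_erase_of_not_linearIndepOn hc ht
    obtain ⟨s, hs, hli, d, hd, h⟩ := ih _ (Finset.erase_ssubset hi) c'
      fun j hj => hc' j (Finset.mem_of_mem_erase hj)
    exact ⟨s, hs.trans (Finset.erase_subset _ _), hli, d, hd, h.trans hsum⟩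

theorem exists_linearIndepOn_of_mem_span {s : Set ι} {x : E}
    (hx : x ∈ Submodule.span NNReal (v '' s)) :
    ∃ t : Finset ι, (t : Set ι) ⊆ s ∧ LinearIndepOn ℝ v (t : Set ι) ∧
      ∃ c : ι → ℝ, (∀ i ∈ t, 0 ≤ c i) ∧ ∑ i ∈ t, c i • v i = x := by
  obtain ⟨l, hl, hx⟩ := (Finsupp.mem_span_image_iff_linearCombination NNReal).1 hx
  obtain ⟨t, ht, hli, c, hc, h⟩ := exists_linearIndepOn_of_nonneg (v := v) l.support
    (fun i => (l i : ℝ)) fun i _ => (l i).2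
  exact ⟨t, (Finset.coe_subset.2 ht).trans hl, hli, c, hc, h.trans hx⟩

theorem sum_smul_mem_span_nnreal {s : Set ι} {t : Finset ι} (hts : (t : Set ι) ⊆ s) {c : ι → ℝ}
    (hc : ∀ i ∈ t, 0 ≤ c i) : ∑ i ∈ t, c i • v i ∈ Submodule.span NNReal (v '' s) :=
  Submodule.sum_mem _ fun i hi => Submodule.smul_mem _ (⟨c i, hc i hi⟩ : NNReal)
    (Submodule.subset_span ⟨i, hts hi, rfl⟩)

variable [TopologicalSpace E] [IsTopologicalAddGroup E] [ContinuousSMul ℝ E] [T2Space E]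

/-- A simplicial cone is the image of a closed orthant under an injective linear map from a
finite-dimensional space, which is a closed embedding. -/
theorem isClosed_nonneg_sums_of_linearIndepOn {t : Finset ι}
    (ht : LinearIndepOn ℝ v (t : Set ι)) :
    IsClosed {x : E | ∃ c : ι → ℝ, (∀ i ∈ t, 0 ≤ c i) ∧ ∑ i ∈ t, c i • v i = x} := by
  let f : (t → ℝ) →ₗ[ℝ] E := Fintype.linearCombination ℝ fun i : t => v i
  have hf : LinearMap.ker f = ⊥ :=
    LinearMap.ker_eq_bot.2 (linearIndependent_iff_injective_fintypeLinearCombination.1 ht)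
  have hcl : IsClosed {c : t → ℝ | ∀ i, 0 ≤ c i} := by
    simp only [Set.ofPred_forall]
    exact isClosed_iInter fun i => isClosed_le continuous_const (continuous_apply i)
  convert (LinearMap.isClosedEmbedding_of_injective hf).isClosedMap _ hcl using 1
  ext x
  constructor
  · rintro ⟨c, hc, rfl⟩
    refine ⟨fun i => c i, fun i => hc i i.2, ?_⟩
    rw [Fintype.linearCombination_apply, Finset.sum_coe_sort t fun i => c i • v i]
  · rintro ⟨c, hc, rfl⟩
    classical
    refine ⟨fun i => if h : i ∈ t then c ⟨i, h⟩ else 0, fun i hi => ?_, ?_⟩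
    · simpa [hi] using hc ⟨i, hi⟩
    · rw [Fintype.linearCombination_apply, ← Finset.sum_coe_sort t]
      simp

/-- By Carathéodory the cone is a finite union of simplicial cones. -/
theorem isClosed_span_nnreal_image {s : Set ι} (hs : s.Finite) :
    IsClosed (Submodule.span NNReal (v '' s) : Set E) := by
  have : (Submodule.span NNReal (v '' s) : Set E) =
      ⋃ t ∈ {t : Finset ι | (t : Set ι) ⊆ s ∧ LinearIndepOn ℝ v (t : Set ι)},
        {x : E | ∃ c : ι → ℝ, (∀ i ∈ t, 0 ≤ c i) ∧ ∑ i ∈ t, c i • v i = x} := by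
    ext x
    simp only [Set.mem_iUnion, exists_prop]
    constructor
    · intro hx
      obtain ⟨t, hts, hli, h⟩ := exists_linearIndepOn_of_mem_span hx
      exact ⟨t, ⟨hts, hli⟩, h⟩
    · rintro ⟨t, ⟨hts, -⟩, c, hc, rfl⟩
      exact sum_smul_mem_span_nnreal hts hc
  rw [this]
  refine Set.Finite.isClosed_biUnion ?_ fun t ht => isClosed_nonneg_sums_of_linearIndepOn ht.2
  refine (hs.toFinset.powerset.finite_toSet).subset fun t ht => ?_
  simpa [← Finset.coe_subset] using ht.1

/-- Farkas' lemma for finitely generated cones. -/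
theorem exists_dual_neg_of_notMem_span [LocallyConvexSpace ℝ E] {s : Set ι} (hs : s.Finite)
    {x : E} (hx : x ∉ Submodule.span NNReal (v '' s)) :
    ∃ f : E →ₗ[ℝ] ℝ, (∀ i ∈ s, 0 ≤ f (v i)) ∧ f x < 0 := by
  let C : ProperCone ℝ E := ⟨Submodule.span NNReal (v '' s), isClosed_span_nnreal_image hs⟩
  obtain ⟨f, hf, hfx⟩ := C.hyperplane_separation_point hx
  exact ⟨f, fun i hi => hf _ (Submodule.subset_span ⟨i, hi, rfl⟩), hfx⟩

end Cone

/-! ### Lattice points of the cone: doubling lands in the edge semigroup. -/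

namespace SignedGraph

/-- `realVec` as an additive map. -/
def realVecHom (V : Type*) : (V → ℤ) →+ (V → ℝ) :=
  (Int.castAddHom ℝ).compLeft V

theorem realVecHom_apply {V : Type*} (a : V → ℤ) : realVecHom V a = realVec a := rfl

variable {V : Type*} [DecidableEq V] {G : SignedGraph V}

/-- Two vertices are related if `e_v ± e_w` lies in the edge lattice for some sign. -/
def latticeSetoid (G : SignedGraph V) : Setoid V where
  r v w := ∃ σ : ℤˣ, (Pi.single v 1 - (σ : ℤ) • Pi.single w 1 : V → ℤ) ∈ G.edgeLattice
  iseqv :=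
    { refl := fun v => ⟨1, by simp⟩
      symm := by
        rintro v w ⟨σ, h⟩
        refine ⟨σ, ?_⟩
        convert zsmul_mem h (-(σ : ℤ)) using 1
        rw [smul_sub, smul_smul, neg_mul, ← Units.val_mul, Int.units_mul_self]
        push_cast
        module
      trans := by
        rintro u v w ⟨σ, h⟩ ⟨τ, h'⟩
        refine ⟨σ * τ, ?_⟩
        convert add_mem h (zsmul_mem h' (σ : ℤ)) using 1
        rw [smul_sub, smul_smul, Units.val_mul]
        module }

/-- If `2 e_r` is not in the edge lattice, there is a potential which vanishes on the edges and is
`±1` exactly on the class of `r`. -/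
theorem exists_potential {r : V} (hr : (2 • Pi.single r 1 : V → ℤ) ∉ G.edgeLattice) :
    ∃ f : V → ℤ, (∀ v, ¬ G.latticeSetoid v r → f v = 0) ∧
      (∀ v, G.latticeSetoid v r → (Pi.single v 1 - f v • Pi.single r 1 : V → ℤ) ∈ G.edgeLattice) ∧
      ∀ (s : ℤˣ) (i j : V), (s, s(i, j)) ∈ G.edges → f i + f j = 0 := by
  classical
  -- If both signs occurred for `v`, the difference would put `±2e_r` in the lattice. Uniqueness
  -- makes the sign a well-defined function of `v`, and it flips along each edge.
  have huniq : ∀ (v : V) (σ τ : ℤˣ),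
      (Pi.single v 1 - (σ : ℤ) • Pi.single r 1 : V → ℤ) ∈ G.edgeLattice →
      (Pi.single v 1 - (τ : ℤ) • Pi.single r 1 : V → ℤ) ∈ G.edgeLattice → σ = τ := by
    intro v σ τ hσ hτ
    by_contra hne
    obtain rfl : τ = -σ := by
      rcases Int.units_eq_one_or σ with rfl | rfl <;>
        rcases Int.units_eq_one_or τ with rfl | rfl <;> simp_all
    apply hr
    convert zsmul_mem (sub_mem hτ hσ) (σ : ℤ) using 1
    have h1 : (σ : ℤ) * σ = 1 := by rw [← Units.val_mul, Int.units_mul_self, Units.val_one]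
    rw [sub_sub_sub_cancel_left, Units.val_neg, neg_smul, sub_neg_eq_add, smul_add, smul_smul, h1]
    module
  refine ⟨fun v => if h : G.latticeSetoid v r then (h.choose : ℤ) else 0, fun v h => dif_neg h,
    fun v h => by simpa only [dif_pos h] using h.choose_spec, fun s i j he => ?_⟩
  have hij : (Pi.single i 1 + Pi.single j 1 : V → ℤ) ∈ G.edgeLattice := by
    convert zsmul_mem (rho_mem_edgeLattice he) (s : ℤ) using 1
    rw [rho_mk, smul_smul, ← Units.val_mul, Int.units_mul_self, Units.val_one, one_smul]
  have hrel : G.latticeSetoid i j := ⟨-1, by simpa using hij⟩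
  by_cases h : G.latticeSetoid i r
  · have h' : G.latticeSetoid j r := G.latticeSetoid.trans (G.latticeSetoid.symm hrel) h
    simp only [dif_pos h, dif_pos h']
    have : h'.choose = -h.choose := huniq j _ _ h'.choose_spec (by
      convert sub_mem hij h.choose_spec using 1
      push_cast
      module)
    rw [this]
    simp
  · have h' : ¬ G.latticeSetoid j r := fun h' => h (G.latticeSetoid.trans hrel h')
    simp only [dif_neg h, dif_neg h', add_zero]

theorem sum_potential_mul_eq_zero [Fintype V] {f : V → ℤ}
    (hf : ∀ (s : ℤˣ) (i j : V), (s, s(i, j)) ∈ G.edges → f i + f j = 0) {a : V → ℤ}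
    (ha : realVec a ∈ Submodule.span ℝ ((fun e => realVec (rho e)) '' G.edges)) :
    ∑ v, a v * f v = 0 := by
  have key : ∀ x ∈ Submodule.span ℝ ((fun e => realVec (rho e)) '' G.edges),
      ∑ v, x v * (f v : ℝ) = 0 := by
    intro x hx
    induction hx using Submodule.span_induction with
    | mem x hx =>
      obtain ⟨⟨s, e⟩, he, rfl⟩ := hx
      induction e using Sym2.ind with
      | _ i j =>
        have h : ∑ v, rho (s, s(i, j)) v * f v = 0 := by
          simp only [rho_mk, Pi.smul_apply, Pi.add_apply, smul_eq_mul, mul_assoc,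
            ← Finset.mul_sum, add_mul, Finset.sum_add_distrib]
          simp [Pi.single_apply, hf s i j he]
        simp only [realVec]
        exact_mod_cast h
    | zero => simp
    | add x y _ _ hx hy => simp [add_mul, Finset.sum_add_distrib, hx, hy]
    | smul c x _ hx => simp [mul_assoc, ← Finset.mul_sum, hx]
  have := key _ ha
  simp only [realVec] at this
  exact_mod_cast this

/-- Work class by class with a representative `r`. If `2e_r` is in the lattice, so is `2e_v` for
every `v` in the class. Otherwise the potential `f` is orthogonal to `a`, and replacing each `e_v`
by the lattice vector `e_v - f(v)e_r` does not change the sum. -/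
theorem two_nsmul_mem_edgeLattice [Finite V] {a : V → ℤ}
    (ha : realVec a ∈ Submodule.span ℝ ((fun e => realVec (rho e)) '' G.edges)) :
    2 • a ∈ G.edgeLattice := by
  classical
  have := Fintype.ofFinite V
  have hsum : 2 • a = ∑ q : Quotient G.latticeSetoid,
      ∑ v with Quotient.mk G.latticeSetoid v = q, (2 * a v) • (Pi.single v 1 : V → ℤ) := by
    rw [Finset.sum_fiberwise]
    funext w
    simp [Finset.sum_apply, Pi.single_apply]
  rw [hsum]
  refine sum_mem fun q _ => ?_
  obtain ⟨r, rfl⟩ := q.exists_rep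
  have hmk : ∀ v, Quotient.mk G.latticeSetoid v = Quotient.mk G.latticeSetoid r ↔
      G.latticeSetoid v r := fun v => Quotient.eq
  simp only [hmk]
  by_cases hr : (2 • Pi.single r 1 : V → ℤ) ∈ G.edgeLattice
  · refine sum_mem fun v hv => ?_
    obtain ⟨σ, hσ⟩ := (Finset.mem_filter.1 hv).2
    convert add_mem (zsmul_mem hσ (2 * a v)) (zsmul_mem hr (a v * σ)) using 1
    module
  · obtain ⟨f, hf0, hf, hfe⟩ := exists_potential hr
    have h0 : ∑ v with G.latticeSetoid v r, a v * f v = 0 := by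
      rw [Finset.sum_filter_of_ne, sum_potential_mul_eq_zero hfe ha]
      intro v _ hv
      by_contra h
      exact hv (by rw [hf0 v h, mul_zero])
    have : ∑ v with G.latticeSetoid v r, (2 * a v) • (Pi.single v 1 : V → ℤ) =
        ∑ v with G.latticeSetoid v r, (2 * a v) • (Pi.single v 1 - f v • Pi.single r 1) := by
      simp only [smul_sub, Finset.sum_sub_distrib, smul_smul, ← Finset.sum_smul]
      simp only [mul_assoc, ← Finset.mul_sum, h0, mul_zero, zero_smul, sub_zero]
    rw [this]
    exact sum_mem fun v hv => zsmul_mem (hf v (Finset.mem_filter.1 hv).2) _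

theorem two_nsmul_mem_edgeSemigroup [Finite V] {a : V → ℤ}
    (ha : realVec a ∈ Submodule.span NNReal G.edgePolytope) : 2 • a ∈ G.edgeSemigroup := by
  rw [span_edgePolytope] at ha
  obtain ⟨t, hts, hli, c, hc, hsum⟩ := exists_linearIndepOn_of_mem_span ha
  -- Only the independent edges are kept, so the integer coefficients of `2a` must equal `2c`, which
  -- is nonnegative.
  let H : SignedGraph V := ⟨t⟩
  have hH : 2 • a ∈ H.edgeLattice := by
    refine two_nsmul_mem_edgeLattice ?_
    rw [← hsum]
    exact Submodule.sum_mem _ fun e he =>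
      Submodule.smul_mem _ _ (Submodule.subset_span ⟨e, he, rfl⟩)
  have hspan : 2 • a ∈ (Submodule.span ℤ (rho '' (t : Set (ℤˣ × Sym2 V)))).toAddSubgroup := by
    rwa [Submodule.span_int_eq_addSubgroupClosure]
  obtain ⟨m, hm⟩ := Submodule.mem_span_image_finset_iff_exists_fun' ℤ |>.1
    ((Submodule.mem_toAddSubgroup _).1 hspan)
  have hcoef : ∀ e ∈ t, (m e : ℝ) - 2 * c e = 0 := by
    refine linearIndepOn_finset_iff.1 hli _ ?_
    have h1 : ∑ e ∈ t, (m e : ℝ) • realVec (rho e) = 2 • realVec a := by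
      have h := congrArg (realVecHom V) hm
      rw [map_sum, map_nsmul] at h
      rw [← realVecHom_apply, ← h]
      exact Finset.sum_congr rfl fun e _ => by
        rw [map_zsmul, ← realVecHom_apply, Int.cast_smul_eq_zsmul]
    simp only [sub_smul, mul_smul, Finset.sum_sub_distrib, ← Finset.smul_sum, h1, hsum]
    module
  rw [← hm]
  refine sum_mem fun e he => ?_
  have hme : 0 ≤ m e := by
    have h1 := hcoef e he
    have h2 := hc e he
    exact_mod_cast (by linarith : (0 : ℝ) ≤ m e)
  lift m e to ℕ using hme with n
  rw [natCast_zsmul]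
  exact nsmul_mem (rho_mem_edgeSemigroup (hts he)) n

theorem realVec_mem_of_two_nsmul_mem {a : V → ℤ} (ha : 2 • a ∈ G.edgeSemigroup) :
    realVec a ∈ Submodule.span NNReal G.edgePolytope := by
  rw [span_edgePolytope]
  have key : ∀ x ∈ G.edgeSemigroup,
      realVecHom V x ∈ Submodule.span NNReal ((fun e => realVec (rho e)) '' G.edges) := by
    intro x hx
    induction hx using AddSubmonoid.closure_induction with
    | mem x hx =>
      obtain ⟨e, he, rfl⟩ := hx
      exact Submodule.subset_span ⟨e, he, rfl⟩
    | zero => rw [map_zero]; exact zero_mem _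
    | add x y _ _ hx hy => rw [map_add]; exact add_mem hx hy
  have h := Submodule.smul_mem _ (2⁻¹ : NNReal) (key _ ha)
  rw [map_nsmul, ← Nat.cast_smul_eq_nsmul NNReal, smul_smul] at h
  simpa [realVecHom_apply] using h

theorem mem_ehrhartSemigroup_iff [Finite V] {a : V → ℤ} :
    a ∈ G.ehrhartSemigroup ↔ 2 • a ∈ G.edgeSemigroup ∧ a ∈ G.edgeLattice :=
  and_congr_left fun _ => ⟨two_nsmul_mem_edgeSemigroup, realVec_mem_of_two_nsmul_mem⟩

/-- The Ehrhart semigroup is generated by the edges and the exceptional pairs. -/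
theorem closure_exceptionalVectors [Finite V] :
    (AddSubmonoid.closure (rho '' G.edges ∪ G.exceptionalVectors) : Set (V → ℤ)) =
      G.ehrhartSemigroup := by
  ext a
  rw [mem_ehrhartSemigroup_iff]
  refine ⟨fun ha => ?_, fun ha => mem_closure_exceptionalVectors ha.2 ha.1⟩
  induction ha using AddSubmonoid.closure_induction with
  | mem x hx =>
    rcases hx with ⟨e, he, rfl⟩ | ⟨u, w, c, c', ⟨hc, hc', -, ⟨p⟩, -⟩, rfl⟩
    · exact ⟨nsmul_mem (rho_mem_edgeSemigroup he) 2, rho_mem_edgeLattice he⟩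
    · refine ⟨?_, c.halfRho_add_halfRho_mem_edgeLattice c' hc.1 hc'.1 p⟩
      rw [smul_add, Walk.two_mul_halfRho, Walk.two_mul_halfRho]
      exact add_mem c.sum_rho_mem_edgeSemigroup c'.sum_rho_mem_edgeSemigroup
  | zero => exact ⟨by simp, zero_mem _⟩
  | add x y _ _ hx hy =>
    exact ⟨by rw [smul_add]; exact add_mem hx.1 hy.1, add_mem hx.2 hy.2⟩

end SignedGraph

/-! ### Laurent polynomials: integral closedness, weights and supports. -/

section Laurent

variable {V : Type*} {k : Type*} [Field k]

/-- The inclusion of the exponents of ordinary monomials into those of Laurent monomials. -/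
def exponentHom (V : Type*) : (V →₀ ℕ) →+ (V → ℤ) where
  toFun a v := a v
  map_zero' := by ext; simp
  map_add' a b := by ext; simp

theorem exponentHom_injective : Function.Injective (exponentHom V) := fun a b h => by
  ext v
  have hv : (a v : ℤ) = b v := congrFun h v
  exact_mod_cast hv

theorem mapDomainRingHom_exponentHom_single (n : V →₀ ℕ) (r : k) :
    AddMonoidAlgebra.mapDomainRingHom k (exponentHom V) (.single n r) =
      .single (exponentHom V n) r :=
  AddMonoidAlgebra.mapDomain_single

theorem laurentMonomial_add (a b : V → ℤ) :
    laurentMonomial k (a + b) = laurentMonomial k a * laurentMonomial k b := by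
  simp [laurentMonomial, AddMonoidAlgebra.single_mul_single]

theorem laurentMonomial_zero : laurentMonomial k (0 : V → ℤ) = 1 := rfl

theorem laurentMonomial_nsmul (n : ℕ) (a : V → ℤ) :
    laurentMonomial k (n • a) = laurentMonomial k a ^ n := by
  simp [laurentMonomial, AddMonoidAlgebra.single_pow]

theorem laurentMonomial_mul_neg (a : V → ℤ) :
    laurentMonomial k a * laurentMonomial k (-a) = 1 := by
  rw [← laurentMonomial_add, add_neg_cancel, laurentMonomial_zero]

theorem exists_mul_laurentMonomial_mem_range [Finite V] (f : Laurent V k) :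
    ∃ (n : V →₀ ℕ) (g : AddMonoidAlgebra k (V →₀ ℕ)),
      f * laurentMonomial k (exponentHom V n) =
        AddMonoidAlgebra.mapDomainRingHom k (exponentHom V) g := by
  induction f using AddMonoidAlgebra.induction_linear with
  | zero => exact ⟨0, 0, by simp⟩
  | add f f' hf hf' =>
    obtain ⟨n, g, h⟩ := hf
    obtain ⟨n', g', h'⟩ := hf'
    refine ⟨n + n', g * .single n' 1 + g' * .single n 1, ?_⟩
    simp only [map_add, map_mul, ← h, ← h', mapDomainRingHom_exponentHom_single,
      laurentMonomial_add]
    simp only [laurentMonomial]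
    ring
  | single a r =>
    -- Multiplying by `x^|a|` clears the negative exponents, as `a + |a| ≥ 0`.
    refine ⟨Finsupp.equivFunOnFinite.symm fun v => (a v).natAbs,
      .single (Finsupp.equivFunOnFinite.symm fun v => (a v + (a v).natAbs).toNat) r, ?_⟩
    rw [mapDomainRingHom_exponentHom_single, laurentMonomial,
      AddMonoidAlgebra.single_mul_single, mul_one]
    congr 1
    funext v
    simp only [exponentHom, AddMonoidHom.coe_mk, ZeroHom.coe_mk, Pi.add_apply,
      Finsupp.equivFunOnFinite_symm_apply_apply]
    omega

/-- The Laurent ring is the localization of a polynomial ring, which is integrally closed, at its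
monomials. -/
instance Laurent.isIntegrallyClosed [Finite V] : IsIntegrallyClosed (Laurent V k) := by
  let A := AddMonoidAlgebra k (V →₀ ℕ)
  have : IsIntegrallyClosed A := inferInstanceAs (IsIntegrallyClosed (MvPolynomial V k))
  let F : A →+* Laurent V k := AddMonoidAlgebra.mapDomainRingHom k (exponentHom V)
  have hF : Function.Injective F := AddMonoidAlgebra.mapDomain_injective exponentHom_injective
  let : Algebra A (Laurent V k) := F.toAlgebra
  let M : Submonoid A := MonoidHom.mrange (AddMonoidAlgebra.of k (V →₀ ℕ))
  have hunit : ∀ y : M, IsUnit (F y) := by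
    rintro ⟨_, a, rfl⟩
    have : F (AddMonoidAlgebra.of k (V →₀ ℕ) a) =
        laurentMonomial k (exponentHom V a.toAdd) :=
      mapDomainRingHom_exponentHom_single _ _
    exact IsUnit.of_mul_eq_one _ (by rw [this]; exact laurentMonomial_mul_neg _)
  have : IsLocalization M (Laurent V k) := by
    rw [isLocalization_iff]
    refine ⟨hunit, fun f => ?_, fun h => ⟨1, by rw [hF h]⟩⟩
    obtain ⟨n, g, h⟩ := exists_mul_laurentMonomial_mem_range f
    refine ⟨⟨g, ⟨_, .ofAdd n, rfl⟩⟩, ?_⟩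
    refine Eq.trans ?_ h
    exact congrArg (f * ·) (mapDomainRingHom_exponentHom_single n 1)
  refine isIntegrallyClosed_of_isLocalization (R := A) (Laurent V k) M fun y hy => ?_
  rw [mem_nonZeroDivisors_iff_ne_zero]
  rintro rfl
  have := hunit ⟨0, hy⟩
  simp at this

/-- The ring homomorphism `x^a ↦ x^a t^{φ(a)}`. -/
noncomputable def weightHom (k : Type*) [Field k] (φ : (V → ℤ) →+ ℝ) :
    Laurent V k →+* HahnSeries ℝ (Laurent V k) :=
  AddMonoidAlgebra.liftNCRingHom (HahnSeries.C.comp (algebraMap k (Laurent V k)))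
    { toFun := fun a => HahnSeries.single (φ a.toAdd) (laurentMonomial k a.toAdd)
      map_one' := by simp [laurentMonomial_zero]
      map_mul' := fun a b => by
        rw [HahnSeries.single_mul_single, toAdd_mul, map_add, laurentMonomial_add] }
    fun _ _ => Commute.all _ _

-- The coefficients retain `x^a`, so distinct monomials of equal weight cannot cancel; the order in
-- `t` therefore detects the least weight on the support.
open Classical in
theorem coeff_weightHom (φ : (V → ℤ) →+ ℝ) (f : Laurent V k) (r : ℝ) (a : V → ℤ) :
    ((weightHom k φ f).coeff r).coeff a = if φ a = r then f.coeff a else 0 := by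
  induction f using AddMonoidAlgebra.induction_linear with
  | zero => simp
  | add f g hf hg =>
    rw [map_add, HahnSeries.coeff_add, AddMonoidAlgebra.coeff_add, Finsupp.add_apply, hf, hg]
    split_ifs <;> simp
  | single b c =>
    have hs : (weightHom k φ (.single b c)).coeff r =
        c • (HahnSeries.single (φ b) (laurentMonomial k b)).coeff r := by
      rw [weightHom, AddMonoidAlgebra.liftNCRingHom_single, RingHom.comp_apply,
        HahnSeries.C_mul_eq_smul, HahnSeries.coeff_smul, smul_eq_mul, ← Algebra.smul_def]
      rfl
    rw [hs, HahnSeries.coeff_single, laurentMonomial, AddMonoidAlgebra.coeff_smul,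
      Finsupp.smul_apply, AddMonoidAlgebra.coeff_single, Finsupp.single_apply]
    by_cases hab : b = a
    · subst hab
      by_cases h : φ b = r
      · simp [h]
      · simp [h, Ne.symm h]
    · by_cases h : r = φ b <;> simp [h, hab]

theorem Valuation.map_le_one_of_isIntegral {R A B Γ₀ : Type*} [CommRing R] [CommRing A]
    [CommRing B] [Algebra R A] [LinearOrderedCommGroupWithZero Γ₀] (v : Valuation B Γ₀)
    (w : A →+* B) (hR : ∀ r : R, v (w (algebraMap R A r)) ≤ 1) {x : A} (hx : IsIntegral R x) :
    v (w x) ≤ 1 := by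
  let ψ : R →+* v.integer := (w.comp (algebraMap R A)).codRestrict v.integer hR
  exact (Valuation.integer.integers v).isIntegral_iff_v_le_one.1 (hx.map_of_comp_eq ψ w rfl)

theorem zero_le_orderTop_weightHom_iff (φ : (V → ℤ) →+ ℝ) (f : Laurent V k) :
    0 ≤ (weightHom k φ f).orderTop ↔ ∀ a ∈ f.coeff.support, 0 ≤ φ a := by
  classical
  constructor
  · intro h a ha
    have hne : (weightHom k φ f).coeff (φ a) ≠ 0 := by
      intro h0
      have := coeff_weightHom φ f (φ a) a
      rw [h0, if_pos rfl] at this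
      exact Finsupp.mem_support_iff.1 ha this.symm
    exact_mod_cast h.trans (HahnSeries.orderTop_le_of_coeff_ne_zero hne)
  · intro h
    by_contra! hlt
    obtain ⟨r, hr⟩ := WithTop.ne_top_iff_exists.1 hlt.ne_top
    rw [← hr] at hlt
    have hr0 : r < 0 := by exact_mod_cast hlt
    refine HahnSeries.coeff_orderTop_ne hr.symm ?_
    ext a
    rw [coeff_weightHom]
    split_ifs with ha
    · by_contra hfa
      have := h a (Finsupp.mem_support_iff.2 hfa)
      linarith
    · rfl

/-- The order in `t` is a valuation, and elements integral over a subring of its valuation ring stay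
in the valuation ring. -/
theorem nonneg_of_isIntegral (φ : (V → ℤ) →+ ℝ) (R : Subalgebra k (Laurent V k))
    (hR : ∀ r ∈ R, ∀ a ∈ r.coeff.support, 0 ≤ φ a) {f : Laurent V k} (hf : IsIntegral R f) :
    ∀ a ∈ f.coeff.support, 0 ≤ φ a := by
  rw [← zero_le_orderTop_weightHom_iff]
  let v := AddValuation.toValuation (HahnSeries.addVal ℝ (Laurent V k))
  have hv : ∀ x, v x ≤ 1 ↔ 0 ≤ x.orderTop := fun x => by
    rw [← HahnSeries.addVal_apply]; exact Iff.rfl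
  exact (hv _).1 (v.map_le_one_of_isIntegral (weightHom k φ)
    (fun r : R => (hv _).2 ((zero_le_orderTop_weightHom_iff φ _).2 (hR r.1 r.2))) hf)

/-- If `f g` and `g ≠ 0` have exponents in a group `L`, so has `f`. -/
theorem support_subset_of_mul (L : AddSubgroup (V → ℤ)) {f g : Laurent V k} (hg0 : g ≠ 0)
    (hg : ∀ a ∈ g.coeff.support, a ∈ L) (hfg : ∀ a ∈ (f * g).coeff.support, a ∈ L) :
    ∀ a ∈ f.coeff.support, a ∈ L := by
  classical
  let f₁ : Laurent V k := .ofCoeff (f.coeff.filter (· ∈ L))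
  let f₂ : Laurent V k := .ofCoeff (f.coeff.filter (· ∉ L))
  have hf : f = f₁ + f₂ := by
    ext a
    by_cases h : a ∈ L <;> simp [f₁, f₂]
  -- Exponents of `f₁ g` lie in `L` and those of `f₂ g` lie outside, so nothing cancels between them
  -- and any term of `f₂ g` would survive in `f g`.
  have h2 : f₂ * g = 0 := by
    rw [← AddMonoidAlgebra.coeff_eq_zero, ← Finsupp.support_eq_empty,
      Finset.eq_empty_iff_forall_notMem]
    intro a ha
    obtain ⟨b, hb, c, hc, rfl⟩ :=
      Finset.mem_add.1 (AddMonoidAlgebra.support_coeff_mul_subset _ _ ha)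
    have hbL : b ∉ L := by
      simp only [f₂, Finsupp.support_filter, Finset.mem_filter] at hb
      exact hb.2
    have hbc : b + c ∉ L := fun h => hbL ((add_mem_cancel_right (hg c hc)).1 h)
    have h1 : (f₁ * g).coeff (b + c) = 0 := by
      by_contra h1
      obtain ⟨b', hb', c', hc', h⟩ := Finset.mem_add.1
        (AddMonoidAlgebra.support_coeff_mul_subset _ _ (Finsupp.mem_support_iff.2 h1))
      simp only [f₁, Finsupp.support_filter, Finset.mem_filter] at hb'
      exact hbc (h ▸ add_mem hb'.2 (hg c' hc'))
    refine hbc (hfg _ (Finsupp.mem_support_iff.2 ?_))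
    rw [hf, add_mul, AddMonoidAlgebra.coeff_add, Finsupp.add_apply, h1, zero_add]
    exact Finsupp.mem_support_iff.1 ha
  have h0 := (mul_eq_zero.1 h2).resolve_right hg0
  rw [hf, h0, add_zero]
  intro a ha
  simp only [f₁, Finsupp.support_filter, Finset.mem_filter] at ha
  exact ha.2

theorem laurentMonomial_mem_adjoin {X : Set (V → ℤ)} {a : V → ℤ}
    (ha : a ∈ AddSubmonoid.closure X) :
    laurentMonomial k a ∈ Algebra.adjoin k (laurentMonomial k '' X) := by
  induction ha using AddSubmonoid.closure_induction with
  | mem x hx => exact Algebra.subset_adjoin ⟨x, hx, rfl⟩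
  | zero => rw [laurentMonomial_zero]; exact one_mem _
  | add x y _ _ hx hy => rw [laurentMonomial_add]; exact mul_mem hx hy

/-- Membership in a semigroup ring is read off the support, which turns the ring statements into
statements on exponents. -/
theorem mem_adjoin_laurentMonomial_iff {X : Set (V → ℤ)} {f : Laurent V k} :
    f ∈ Algebra.adjoin k (laurentMonomial k '' X) ↔
      ∀ a ∈ f.coeff.support, a ∈ AddSubmonoid.closure X := by
  classical
  constructor
  · intro hf
    induction hf using Algebra.adjoin_induction with
    | mem x hx =>
      obtain ⟨a, ha, rfl⟩ := hx
      intro b hb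
      rw [Finset.mem_singleton.1 (Finsupp.support_single_subset hb)]
      exact AddSubmonoid.subset_closure ha
    | algebraMap r =>
      intro b hb
      rw [Finset.mem_singleton.1 (Finsupp.support_single_subset hb)]
      exact zero_mem _
    | add x y _ _ hx hy =>
      intro a ha
      exact (Finset.mem_union.1 (Finsupp.support_add ha)).elim (hx a) (hy a)
    | mul x y _ _ hx hy =>
      intro a ha
      obtain ⟨b, hb, c, hc, rfl⟩ :=
        Finset.mem_add.1 (AddMonoidAlgebra.support_coeff_mul_subset _ _ ha)
      exact add_mem (hx b hb) (hy c hc)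
  · intro h
    have hsum : f = ∑ a ∈ f.coeff.support, f.coeff a • laurentMonomial k a := by
      ext b
      simp [laurentMonomial, Finsupp.single_apply]
    rw [hsum]
    exact sum_mem fun a ha => Subalgebra.smul_mem _ (laurentMonomial_mem_adjoin (h a ha)) _

theorem adjoin_laurentMonomial_closure (X : Set (V → ℤ)) :
    Algebra.adjoin k (laurentMonomial k '' (AddSubmonoid.closure X : Set (V → ℤ))) =
      Algebra.adjoin k (laurentMonomial k '' X) := by
  ext f
  rw [mem_adjoin_laurentMonomial_iff, mem_adjoin_laurentMonomial_iff, AddSubmonoid.closure_eq]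

theorem exists_div_of_mem_closure {R : Subalgebra k (Laurent V k)} {z : FractionRing (Laurent V k)}
    (hz : z ∈ Subfield.closure (algebraMap (Laurent V k) (FractionRing (Laurent V k)) ''
      (R : Set (Laurent V k)))) :
    ∃ x ∈ R, ∃ y ∈ R, algebraMap (Laurent V k) (FractionRing (Laurent V k)) x /
      algebraMap (Laurent V k) (FractionRing (Laurent V k)) y = z := by
  have hcl : Subring.closure (algebraMap (Laurent V k) (FractionRing (Laurent V k)) ''
      (R : Set (Laurent V k))) =
      R.toSubring.map (algebraMap (Laurent V k) (FractionRing (Laurent V k))) :=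
    Subring.closure_eq (R.toSubring.map (algebraMap (Laurent V k) (FractionRing (Laurent V k))))
  obtain ⟨_, hx, _, hy, h⟩ := Subfield.mem_closure_iff.1 hz
  rw [hcl] at hx hy
  obtain ⟨x, hx, rfl⟩ := hx
  obtain ⟨y, hy, rfl⟩ := hy
  exact ⟨x, hx, y, hy, h⟩

end Laurent

/-! ### From semigroups to rings: generators and normalization. -/

namespace SignedGraph

variable {V : Type*} [DecidableEq V] (G : SignedGraph V) (k : Type*) [Field k]

theorem edgeRing_eq : G.edgeRing k = Algebra.adjoin k (laurentMonomial k '' (rho '' G.edges)) := by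
  rw [edgeRing, Set.image_image]

theorem exceptionalMonomials_eq :
    G.exceptionalMonomials k = laurentMonomial k '' G.exceptionalVectors := by
  ext m
  constructor
  · rintro ⟨u, w, c, c', h, rfl⟩
    exact ⟨_, ⟨u, w, c, c', h, rfl⟩, rfl⟩
  · rintro ⟨_, ⟨u, w, c, c', h, rfl⟩, rfl⟩
    exact ⟨u, w, c, c', h, rfl⟩

theorem adjoin_exceptionalMonomials [Finite V] :
    (Algebra.adjoin (G.edgeRing k) (G.exceptionalMonomials k)).restrictScalars k =
      G.ehrhartRing k := by
  rw [ehrhartRing, ← closure_exceptionalVectors, adjoin_laurentMonomial_closure, Set.image_union,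
    exceptionalMonomials_eq, Algebra.adjoin_union_eq_adjoin_adjoin, ← edgeRing_eq]

variable {G k}

theorem mem_ehrhartRing_iff [Finite V] {f : Laurent V k} :
    f ∈ G.ehrhartRing k ↔ ∀ a ∈ f.coeff.support, a ∈ G.ehrhartSemigroup := by
  rw [ehrhartRing, mem_adjoin_laurentMonomial_iff, ← closure_exceptionalVectors,
    AddSubmonoid.closure_eq]
  rfl

theorem mem_edgeRing_iff {f : Laurent V k} :
    f ∈ G.edgeRing k ↔ ∀ a ∈ f.coeff.support, a ∈ G.edgeSemigroup := by
  rw [edgeRing_eq, mem_adjoin_laurentMonomial_iff]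
  rfl

theorem isIntegral_of_mem_ehrhartRing [Finite V] {f : Laurent V k} (hf : f ∈ G.ehrhartRing k) :
    IsIntegral (G.edgeRing k) f := by
  have hle : G.ehrhartRing k ≤
      (integralClosure (G.edgeRing k) (Laurent V k)).restrictScalars k := by
    refine Algebra.adjoin_le ?_
    rintro _ ⟨a, ha, rfl⟩
    -- The square of `x^a` is `x^(2a)`, and `2a` is in the edge semigroup.
    refine IsIntegral.of_pow (n := 2) two_pos ?_
    rw [← laurentMonomial_nsmul]
    have h : laurentMonomial k (2 • a) ∈ G.edgeRing k := by
      rw [edgeRing_eq]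
      exact laurentMonomial_mem_adjoin (mem_ehrhartSemigroup_iff.1 ha).1
    exact isIntegral_algebraMap (R := G.edgeRing k) (x := ⟨_, h⟩)
  exact hle hf

theorem algebraMap_laurentMonomial_mem_closure {a : V → ℤ} (ha : a ∈ G.edgeLattice) :
    algebraMap (Laurent V k) (FractionRing (Laurent V k)) (laurentMonomial k a) ∈
      Subfield.closure (algebraMap (Laurent V k) (FractionRing (Laurent V k)) ''
        (G.edgeRing k : Set (Laurent V k))) := by
  induction ha using AddSubgroup.closure_induction with
  | mem x hx =>
    refine Subfield.subset_closure ⟨_, ?_, rfl⟩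
    rw [edgeRing_eq]
    exact Algebra.subset_adjoin ⟨x, hx, rfl⟩
  | zero => rw [laurentMonomial_zero, map_one]; exact one_mem _
  | add x y _ _ hx hy => rw [laurentMonomial_add, map_mul]; exact mul_mem hx hy
  | neg x _ hx =>
    have h := congrArg (algebraMap (Laurent V k) (FractionRing (Laurent V k)))
      (laurentMonomial_mul_neg (k := k) x)
    rw [map_mul, map_one] at h
    rw [eq_inv_of_mul_eq_one_right h]
    exact inv_mem hx

theorem algebraMap_mem_closure_of_mem_ehrhartRing {f : Laurent V k} (hf : f ∈ G.ehrhartRing k) :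
    algebraMap (Laurent V k) (FractionRing (Laurent V k)) f ∈
      Subfield.closure (algebraMap (Laurent V k) (FractionRing (Laurent V k)) ''
        (G.edgeRing k : Set (Laurent V k))) := by
  induction hf using Algebra.adjoin_induction with
  | mem x hx =>
    obtain ⟨a, ha, rfl⟩ := hx
    exact algebraMap_laurentMonomial_mem_closure ha.2
  | algebraMap r => exact Subfield.subset_closure ⟨_, (G.edgeRing k).algebraMap_mem r, rfl⟩
  | add x y _ _ hx hy => rw [map_add]; exact add_mem hx hy
  | mul x y _ _ hx hy => rw [map_mul]; exact mul_mem hx hy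

theorem support_subset_edgeLattice {f : Laurent V k}
    (hf : algebraMap (Laurent V k) (FractionRing (Laurent V k)) f ∈
      Subfield.closure (algebraMap (Laurent V k) (FractionRing (Laurent V k)) ''
        (G.edgeRing k : Set (Laurent V k)))) :
    ∀ a ∈ f.coeff.support, a ∈ G.edgeLattice := by
  obtain ⟨x, hx, y, hy, h⟩ := exists_div_of_mem_closure hf
  have hinj := IsFractionRing.injective (Laurent V k) (FractionRing (Laurent V k))
  by_cases hy0 : y = 0
  · have hf0 : f = 0 := hinj (by rw [← h, hy0]; simp)
    simp [hf0]
  have hfy : f * y = x := by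
    apply hinj
    rw [map_mul, ← h, div_mul_cancel₀]
    rwa [Ne, map_eq_zero_iff _ hinj]
  refine support_subset_of_mul G.edgeLattice hy0 (fun a ha => ?_) fun a ha => ?_
  · exact edgeSemigroup_le_edgeLattice (mem_edgeRing_iff.1 hy a ha)
  · rw [hfy] at ha
    exact edgeSemigroup_le_edgeLattice (mem_edgeRing_iff.1 hx a ha)

/-- An exponent outside the cone is separated from it by a functional that is nonnegative on all
edges; its weight would be negative on an integral element. -/
theorem realVec_mem_of_isIntegral [Finite V] {f : Laurent V k} (hf : IsIntegral (G.edgeRing k) f) :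
    ∀ a ∈ f.coeff.support, realVec a ∈ Submodule.span NNReal G.edgePolytope := by
  intro a ha
  rw [span_edgePolytope]
  by_contra hcon
  obtain ⟨φ, hφ, hneg⟩ := exists_dual_neg_of_notMem_span (Set.toFinite G.edges) hcon
  refine hneg.not_ge (nonneg_of_isIntegral (φ.toAddMonoidHom.comp (realVecHom V)) (G.edgeRing k)
    (fun r hr b hb => ?_) hf a ha)
  replace hb := mem_edgeRing_iff.1 hr b hb
  induction hb using AddSubmonoid.closure_induction with
  | mem x hx =>
    obtain ⟨e, he, rfl⟩ := hx
    exact hφ e he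
  | zero => rw [map_zero]
  | add x y _ _ hx hy => rw [map_add]; exact add_nonneg hx hy

theorem image_ehrhartRing_eq_normalizationSet [Finite V] :
    algebraMap (Laurent V k) (FractionRing (Laurent V k)) '' (G.ehrhartRing k : Set (Laurent V k)) =
      normalizationSet (G.edgeRing k) := by
  ext z
  constructor
  · rintro ⟨f, hf, rfl⟩
    exact ⟨algebraMap_mem_closure_of_mem_ehrhartRing hf,
      (isIntegral_of_mem_ehrhartRing hf).algebraMap⟩
  · rintro ⟨hz, hint⟩
    -- Being integral over the larger Laurent ring, `z` is itself a Laurent polynomial, so its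
    -- exponents can be tested one by one.
    obtain ⟨f, rfl⟩ := IsIntegrallyClosed.isIntegral_iff.1 (hint.tower_top (A := Laurent V k))
    have hf : IsIntegral (G.edgeRing k) f :=
      (isIntegral_algebraMap_iff (IsFractionRing.injective _ _)).1 hint
    refine ⟨f, mem_ehrhartRing_iff.2 fun a ha => ⟨realVec_mem_of_isIntegral hf a ha, ?_⟩, rfl⟩
    exact support_subset_edgeLattice hz a ha

end SignedGraph

theorem mainTheorem4 {V : Type*} [Finite V] [DecidableEq V] (k : Type*) [Field k]
    (G : SignedGraph V) :
    (Algebra.adjoin (G.edgeRing k) (G.exceptionalMonomials k)).restrictScalars k =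
        G.ehrhartRing k ∧
      algebraMap (Laurent V k) (FractionRing (Laurent V k)) '' (G.ehrhartRing k : Set (Laurent V k)) =
        normalizationSet (G.edgeRing k) :=
  ⟨G.adjoin_exceptionalMonomials k, SignedGraph.image_ehrhartRing_eq_normalizationSet⟩
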